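/- Let $n\ge1$ and let $p:\mathbb R^n\to[1,\infty)$ be a bounded measurable exponent; write $p^-=\operatorname{ess\,inf}_{\mathbb R^n}p$ and $p^+=\operatorname{ess\,sup}_{\mathbb R^n}p$. Assume that $1<p^-\le p^+<\infty$, that $1/p$ is log-Hölder continuous (there is $L$ with $|1/p(x)-1/p(y)|\le L/\log(e+1/|x-y|)$ for all $x\ne y$), and that $p^->n$. Let $\mathcal A:\mathbb R^n\times\mathbb R\times\mathbb R^n\to\mathbb R^n$ be a Carathéodory map ($\mathcal A(x,t,\xi)$ is measurable in $x$ and continuous in $(t,\xi)$) of $p(\cdot)$-growth: there are measurable functions $a,b:\mathbb R^n\to\mathbb R$ and constants $a_-,b^+$ with $0<a_-\le a\le b\le b^+<\infty$ such that $$\langle\mathcal A(x,t,\xi),\xi\rangle\ge a(x)|\xi|^{p(x)},\qquad |\mathcal A(x,t,\xi)|\le b(x)|\xi|^{p(x)-1}\qquad\text{for all }(x,t,\xi).$$ Let $f:[0,\infty)\to[0,\infty)$ be continuous and strictly convex. Let $u\in W^{1,p(\cdot)}_{loc}(\mathbb R^n)$, $u\ge0$ a.e., be a supersolution of $\operatorname{div}\mathcal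 A(x,u,\nabla u)\ge f(u)$ in $\mathbb R^n$, that is, $$-\int_{\mathbb R^n}\langle\mathcal A(x,u,\nabla u),\nabla\phi\rangle\,dx\ \ge\ \int_{\mathbb R^n}f(u)\,\phi\,dx\qquad\text{for all nonnegative }\phi\in C_0^\infty(\mathbb R^n).$$ Here $W^{1,p(\cdot)}_{loc}(\mathbb R^n)$ consists of the functions $u$ with a distributional gradient $\nabla u$ such that $\int_K|u/\mu|^{p(x)}dx$ and $\int_K|\nabla u/\mu|^{p(x)}dx$ are finite for every compact $K$ and some $\mu=\mu(K)>0$. Suppose that for some constants $C$ and $\alpha$ with $$\alpha<\frac{p^-}{p^+}-\frac n{p^+}$$ one has $|u(x)|\le C|x|^\alpha$ for a.e. $x\in\mathbb R^n$. Then $u$ is constant (almost everywhere). -/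

import Mathlib

open MeasureTheory Set
open scoped ENNReal ContDiff

noncomputable section

namespace VarExp

/-- Euclidean space `ℝⁿ`. -/
abbrev E (n : ℕ) : Type := EuclideanSpace ℝ (Fin n)

variable {n : ℕ}

/-- `p⁻`, the essential infimum of `p` over `ℝⁿ`
(the honest one as soon as `p` is essentially bounded). -/
def pMinus (p : E n → ℝ) : ℝ := essInf p volume

/-- `p⁺`, the essential supremum of `p` over `ℝⁿ`
(the honest one as soon as `p` is essentially bounded). -/
def pPlus (p : E n → ℝ) : ℝ := essSup p volume

/-- Log-Hölder continuity on `ℝⁿ`: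
`|h x - h y| ≤ L / log (e + 1 / |x - y|)` for all `x`, `y`. For `x = y` the left side is `0`. -/
def LogHolder (h : E n → ℝ) : Prop :=
  ∃ L : ℝ, ∀ x y : E n, |h x - h y| ≤ L / Real.log (Real.exp 1 + 1 / dist x y)

/-- Bounded variable exponents on `ℝⁿ`: measurable, with values in `[1, ∞)`,
`1 < p⁻ ≤ p⁺ < ∞`, and `1 / p` log-Hölder continuous. -/
structure IsExponent (p : E n → ℝ) : Prop where
  measurable : Measurable p
  one_le : ∀ x, 1 ≤ p x
  /-- `p⁺ < ∞` -/
  ess_bdd : ∃ M : ℝ, ∀ᵐ x : E n, p x ≤ M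
  /-- `1 < p⁻` -/
  one_lt : 1 < pMinus p
  logHolder : LogHolder (fun x => 1 / p x)

/-- `w ∈ L^{p(·)}(s)`: `w` is (Lebesgue) measurable on `s` and the modular of `w / μ` over `s`
is finite for some `μ > 0`. -/
def MemLpVar {F : Type*} [NormedAddCommGroup F] (p : E n → ℝ) (s : Set (E n)) (w : E n → F) :
    Prop :=
  AEStronglyMeasurable w (volume.restrict s) ∧
    ∃ μ : ℝ, 0 < μ ∧ ∫⁻ x in s, ENNReal.ofReal ((‖w x‖ / μ) ^ p x) < ⊤

/-- `w ∈ L^{p(·)}_loc(ℝⁿ)`. -/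
def MemLpVarLoc {F : Type*} [NormedAddCommGroup F] (p : E n → ℝ) (w : E n → F) : Prop :=
  ∀ K : Set (E n), IsCompact K → MemLpVar p K w

/-- `φ ∈ C₀^∞(ℝⁿ)`. -/
def IsTest (φ : E n → ℝ) : Prop := ContDiff ℝ ∞ φ ∧ HasCompactSupport φ

/-- `g` is the distributional gradient of `u`:
`∫ u ∇φ = - ∫ φ g` for every test function `φ`. -/
def HasWeakGradient (u : E n → ℝ) (g : E n → E n) : Prop :=
  LocallyIntegrable u ∧ LocallyIntegrable g ∧
    ∀ φ : E n → ℝ, IsTest φ → ∫ x, u x • gradient φ x = - ∫ x, φ x • g x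

/-- `u ∈ W^{1,p(·)}_loc(ℝⁿ)`, with distributional gradient `g` (unique almost everywhere). -/
def MemW1pLoc (p : E n → ℝ) (u : E n → ℝ) (g : E n → E n) : Prop :=
  HasWeakGradient u g ∧ MemLpVarLoc p u ∧ MemLpVarLoc p g

/-- Carathéodory maps `A(x, t, ξ)`: (Lebesgue) measurable in `x`, continuous in `(t, ξ)`. -/
def IsCaratheodory (A : E n → ℝ → E n → E n) : Prop :=
  (∀ t ξ, AEMeasurable (fun x => A x t ξ) volume) ∧
    ∀ x, Continuous (fun q : ℝ × E n => A x q.1 q.2)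

/-- Operators of nonstandard growth (`p(·)`-growth):
`⟨A(x, t, ξ), ξ⟩ ≥ a(x) |ξ|^{p(x)}` and `|A(x, t, ξ)| ≤ b(x) |ξ|^{p(x) - 1}`,
where `0 < a₋ ≤ a ≤ b ≤ b⁺ < ∞`. -/
def HasGrowth (p : E n → ℝ) (A : E n → ℝ → E n → E n) : Prop :=
  IsCaratheodory A ∧
    ∃ (a b : E n → ℝ) (aMinus bPlus : ℝ),
      AEMeasurable a volume ∧ AEMeasurable b volume ∧ 0 < aMinus ∧
      (∀ x, aMinus ≤ a x) ∧ (∀ x, a x ≤ b x) ∧ (∀ x, b x ≤ bPlus) ∧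
      (∀ x t ξ, a x * ‖ξ‖ ^ p x ≤ inner ℝ (A x t ξ) ξ) ∧
      (∀ x t ξ, ‖A x t ξ‖ ≤ b x * ‖ξ‖ ^ (p x - 1))

/-- `u ∈ W^{1,p(·)}_loc(ℝⁿ)` is a supersolution of `div A(x, u, ∇u) ≥ f(u)` in `ℝⁿ`, for an `f`
that is nonnegative on the range of `u`:
`- ∫ ⟨A(x, u, ∇u), ∇φ⟩ ≥ ∫ f(u) φ` for all nonnegative test functions `φ`.
The integrand `f(u) φ` is nonnegative, so the right-hand side is taken with its value in `[0, ∞]`,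
and the inequality contains that it is finite. -/
def IsSupersolution (p : E n → ℝ) (A : E n → ℝ → E n → E n) (f : ℝ → ℝ) (u : E n → ℝ) : Prop :=
  ∃ g : E n → E n, MemW1pLoc p u g ∧
    ∀ φ : E n → ℝ, IsTest φ → (∀ x, 0 ≤ φ x) →
      ((∫⁻ x, ENNReal.ofReal (f (u x) * φ x) : ℝ≥0∞) : EReal) ≤
        ((- ∫ x, inner ℝ (A x (u x) (g x)) (gradient φ x) : ℝ) : EReal)

end VarExp

end

namespace VarExp

open Filter Topology

variable {n : ℕ} {p : E n → ℝ}

/-! ### Exponents -/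

/-! Since `f(u) ≥ 0`, the field `V = A(x, u, ∇u)` satisfies `div V ≥ 0` weakly, and the theorem
follows from a Caccioppoli estimate for such `u`. Put `β = max α 0` and let `M` be of order `R ^ β`,
so that `u ≤ M` on the annulus `R ≤ |x| ≤ 2R`. Test with `Ψ(u) η ^ (m + 1)`, where `Ψ(t) = M
arctan(t / M)` and `η` cuts off between the balls of radius `R` and `2R`. The term with `Ψ'(u)`
controls `|∇u| ^ p / (1 + (u / M) ^ 2)`. The term with `∇η` lives on the annulus, where `Ψ'(u) ≥
1/2`, so Young's inequality absorbs it up to an error of order `(M / R) ^ p`. Integration gives the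
bound `T R ^ (n + (β - 1) p⁻)` (`exists_energy_bound`). The assumption on `α` together with `p⁻ > n`
makes this exponent negative, and `R → ∞` yields `∇u = 0`.

The delicate point is that the test function is not smooth. `u` is mollified, and log-Hölder
continuity gives `|∇u * ρ| ^ p ≤ C (|∇u| ^ p + 1) * ρ` uniformly in the mollifier `ρ`
(`exists_norm_mollify_rpow_le`). This majorant varies with `ρ` but keeps its integral, which is what
the generalized dominated convergence theorem needs (`integrable_and_integral_nonpos_of_comp_mul`).
-/

theorem LogHolder.continuous {h : E n → ℝ} (hh : LogHolder h) : Continuous h := by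
  obtain ⟨L, hL⟩ := hh
  rw [continuous_iff_continuousAt]
  intro x
  rw [continuousAt_iff_punctured_nhds, tendsto_iff_dist_tendsto_zero]
  have h1 : Tendsto (fun y => dist y x) (𝓝[≠] x) (𝓝[>] 0) := by
    refine tendsto_nhdsWithin_iff.2 ⟨?_, ?_⟩
    · have : Tendsto (fun y => dist y x) (𝓝 x) (𝓝 (dist x x)) :=
        (continuous_id.dist continuous_const).tendsto x
      rw [dist_self] at this
      exact this.mono_left nhdsWithin_le_nhds
    · filter_upwards [self_mem_nhdsWithin] with y hy
      exact dist_pos.2 hy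
  have h2 : Tendsto (fun y => Real.log (Real.exp 1 + 1 / dist y x)) (𝓝[≠] x) atTop := by
    refine Real.tendsto_log_atTop.comp (tendsto_atTop_add_const_left _ _ ?_)
    simp only [one_div]
    exact tendsto_inv_nhdsGT_zero.comp h1
  refine squeeze_zero (fun _ => dist_nonneg) (fun y => ?_) (h2.const_div_atTop L)
  rw [Real.dist_eq]
  exact hL y x

/-- The modulus of continuity increases with the distance once `L` is replaced by `|L|`, so it
bounds the oscillation at the scale `ε` of a mollifier. -/
theorem LogHolder.exists_bound {h : E n → ℝ} (hh : LogHolder h) :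
    ∃ L : ℝ, 0 ≤ L ∧ ∀ ε : ℝ, 0 < ε → ∀ x y : E n, dist x y ≤ ε →
      |h x - h y| ≤ L / Real.log (Real.exp 1 + 1 / ε) := by
  obtain ⟨L, hL⟩ := hh
  refine ⟨|L|, abs_nonneg L, fun ε hε x y hxy => ?_⟩
  have hlog : ∀ t : ℝ, 0 < t → 0 < Real.log (Real.exp 1 + 1 / t) := fun t ht => by
    apply Real.log_pos
    have := Real.add_one_le_exp (1 : ℝ)
    have : 0 < 1 / t := by positivity
    linarith
  rcases eq_or_ne x y with rfl | hne
  · simp only [sub_self, abs_zero]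
    exact div_nonneg (abs_nonneg _) (hlog ε hε).le
  · have hd := dist_pos.2 hne
    calc |h x - h y| ≤ L / Real.log (Real.exp 1 + 1 / dist x y) := hL x y
      _ ≤ |L| / Real.log (Real.exp 1 + 1 / dist x y) := by
        gcongr
        · exact (hlog _ hd).le
        · exact le_abs_self L
      _ ≤ |L| / Real.log (Real.exp 1 + 1 / ε) := by
        gcongr
        exact hlog ε hε

theorem IsExponent.pos (hp : IsExponent p) (x : E n) : 0 < p x :=
  one_pos.trans_le (hp.one_le x)

theorem IsExponent.continuous (hp : IsExponent p) : Continuous p := by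
  have h := hp.logHolder.continuous.inv₀ (fun x => (one_div_pos.2 (hp.pos x)).ne')
  convert h using 1
  ext x
  simp

/-- An almost everywhere bound holds on a dense set, and continuity of `p` carries it to every
point. -/
theorem IsExponent.pMinus_le (hp : IsExponent p) (x : E n) : pMinus p ≤ p x := by
  have h : ∀ᵐ x : E n, pMinus p ≤ p x :=
    ae_essInf_le ⟨1, by simpa using Eventually.of_forall hp.one_le⟩
  exact (isClosed_le continuous_const hp.continuous).closure_subset
    ((Measure.dense_of_ae h) x)

theorem IsExponent.le_pPlus (hp : IsExponent p) (x : E n) : p x ≤ pPlus p := by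
  obtain ⟨M, hM⟩ := hp.ess_bdd
  have h : ∀ᵐ x : E n, p x ≤ pPlus p :=
    ae_le_essSup ⟨M, by simpa using hM⟩
  exact (isClosed_le hp.continuous continuous_const).closure_subset
    ((Measure.dense_of_ae h) x)

theorem IsExponent.pPlus_pos (hp : IsExponent p) : 0 < pPlus p :=
  (hp.pos 0).trans_le (hp.le_pPlus 0)

/-- A quantity of polynomial growth in `1 / ε`, raised to a power of order `1 / log (1 / ε)`,
stays bounded. -/
theorem rpow_div_log_le {S Λ ε a : ℝ} (d : ℕ) (ha : 0 ≤ a) (hS : 1 ≤ S) (hΛ : 1 ≤ Λ) (hε : 0 < ε)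
    (h : S ≤ Λ / ε ^ d) :
    S ^ (a / Real.log (Real.exp 1 + 1 / ε)) ≤ Real.exp (a * (Real.log Λ + d)) := by
  set l := Real.log (Real.exp 1 + 1 / ε) with hl
  have hε' : 0 < 1 / ε := by positivity
  have hl1 : 1 ≤ l := by
    rw [hl, Real.le_log_iff_exp_le (by positivity)]
    linarith
  have hl2 : Real.log (1 / ε) ≤ l := Real.log_le_log hε' (by linarith [Real.exp_pos 1])
  have hS0 : 0 < S := by linarith
  rw [Real.rpow_def_of_pos hS0, Real.exp_le_exp]
  have h1 : Real.log S ≤ Real.log Λ + d * Real.log (1 / ε) := by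
    have := Real.log_le_log hS0 h
    rwa [Real.log_div (by positivity) (by positivity), Real.log_pow, sub_eq_add_neg, ← mul_neg,
      ← Real.log_inv, ← one_div] at this
  have h2 : 0 ≤ Real.log Λ := Real.log_nonneg hΛ
  have h3 : Real.log S ≤ (Real.log Λ + d) * l := by
    have : (d : ℝ) * Real.log (1 / ε) ≤ d * l := by gcongr
    nlinarith
  have hl0 : 0 < l := by linarith
  rw [mul_div_assoc', div_le_iff₀ hl0]
  nlinarith [mul_le_mul_of_nonneg_left h3 ha]

/-- The left side is at most the `q`-th power of the larger of `s` and `t`. This crude form of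
Young's inequality includes `q = 1`. -/
theorem rpow_sub_one_mul_le {s t q : ℝ} (hs : 0 ≤ s) (ht : 0 ≤ t) (hq : 1 ≤ q) :
    s ^ (q - 1) * t ≤ s ^ q + t ^ q := by
  have key : ∀ r : ℝ, 0 ≤ r → r ^ (q - 1) * r = r ^ q := fun r hr => by
    rcases hr.eq_or_lt with rfl | hr
    · rw [mul_zero, Real.zero_rpow (by linarith)]
    · rw [← Real.rpow_add_one hr.ne', sub_add_cancel]
  have hs' := Real.rpow_nonneg hs q
  have ht' := Real.rpow_nonneg ht q
  rcases le_total t s with h | h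
  · have := mul_le_mul_of_nonneg_left h (Real.rpow_nonneg hs (q - 1))
    rw [key s hs] at this
    linarith
  · have := mul_le_mul_of_nonneg_right (Real.rpow_le_rpow hs h (by linarith : 0 ≤ q - 1)) ht
    rw [key t ht] at this
    linarith

/-- Young's inequality with a cutoff factor `η`. -/
theorem mul_rpow_sub_one_mul_pow_le {t y η q δ : ℝ} {m : ℕ} (ht : 0 ≤ t) (hy : 0 ≤ y)
    (hη : 0 ≤ η) (hη1 : η ≤ 1) (hq : 1 ≤ q) (hm : q ≤ m + 1) (hδ : 0 < δ) :
    t * (y ^ (q - 1) * η ^ m) ≤ δ * (y ^ q * η ^ (m + 1)) + δ * (t / δ) ^ q := by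
  have key : ∀ r : ℝ, 0 ≤ r → r ^ (q - 1) * r = r ^ q := fun r hr => by
    rcases hr.eq_or_lt with rfl | hr
    · rw [mul_zero, Real.zero_rpow (by linarith)]
    · rw [← Real.rpow_add_one hr.ne', sub_add_cancel]
  have hyq := Real.rpow_nonneg hy q
  have hyq1 := Real.rpow_nonneg hy (q - 1)
  have htd : 0 ≤ t / δ := by positivity
  have htq := Real.rpow_nonneg htd q
  -- Either `t ≤ δ η y`, and the first term on the right suffices, or `η y < t / δ` up to equality,
  -- and the second does. The latter case needs `m ≥ q - 1`.
  rcases le_total t (δ * (η * y)) with h | h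
  · have := mul_le_mul_of_nonneg_right h (mul_nonneg hyq1 (pow_nonneg hη m))
    have e : δ * (η * y) * (y ^ (q - 1) * η ^ m) = δ * (y ^ q * η ^ (m + 1)) := by
      rw [← key y hy]; ring
    have : 0 ≤ δ * (t / δ) ^ q := by positivity
    linarith
  · have h1 : η * y ≤ t / δ := by rw [le_div_iff₀ hδ]; linarith
    have h2 : η ^ m ≤ η ^ (q - 1) := by
      rcases hη.eq_or_lt with rfl | hη0
      -- For `η = 0` and `m = 0` the exponent is `q = 1`, and both sides are `0 ^ 0 = 1`.
      · rcases m.eq_zero_or_pos with rfl | hm0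
        · have : q - 1 = 0 := by push_cast at hm; linarith
          simp [this]
        · rw [zero_pow hm0.ne']; exact Real.rpow_nonneg le_rfl _
      · rw [← Real.rpow_natCast]
        exact Real.rpow_le_rpow_of_exponent_ge hη0 hη1 (by linarith)
    have h3 : y ^ (q - 1) * η ^ m ≤ (t / δ) ^ (q - 1) := calc
      y ^ (q - 1) * η ^ m ≤ y ^ (q - 1) * η ^ (q - 1) := by gcongr
      _ = (η * y) ^ (q - 1) := by rw [Real.mul_rpow hη hy, mul_comm]
      _ ≤ (t / δ) ^ (q - 1) := Real.rpow_le_rpow (by positivity) h1 (by linarith)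
    have h4 : t * (t / δ) ^ (q - 1) = δ * (t / δ) ^ q := by
      rw [← key _ htd]; field_simp
    have := mul_le_mul_of_nonneg_left h3 ht
    have : 0 ≤ δ * (y ^ q * η ^ (m + 1)) := by positivity
    linarith

/-! ### Measurability and integrability -/

/-- Superposition of a Carathéodory map with measurable functions. -/
theorem IsCaratheodory.aemeasurable_comp {A : E n → ℝ → E n → E n} (hA : IsCaratheodory A)
    {u : E n → ℝ} {g : E n → E n} (hu : AEMeasurable u) (hg : AEMeasurable g) :
    AEMeasurable fun x => A x (u x) (g x) := by
  have hw : StronglyMeasurable fun x => (hu.mk u x, hg.mk g x) :=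
    (hu.measurable_mk.prodMk hg.measurable_mk).stronglyMeasurable
  have h1 : AEMeasurable fun x => A x (hu.mk u x) (hg.mk g x) := by
    -- Approximate `(u, g)` by simple functions. On each of their countably many level sets the
    -- arguments `(t, ξ)` are frozen, and continuity in `(t, ξ)` passes to the limit.
    refine aemeasurable_of_tendsto_metrizable_ae' (f := fun i x => A x (hw.approx i x).1
      (hw.approx i x).2) (fun i => ?_) (Eventually.of_forall fun x => ?_)
    · set s := hw.approx i
      have hU : (⋃ c : s.range, s ⁻¹' {(c : ℝ × E n)}) = univ := by
        ext x; simp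
      rw [← Measure.restrict_univ (μ := (volume : Measure (E n))), ← hU, aemeasurable_iUnion_iff]
      intro c
      refine ((hA.1 c.1.1 c.1.2).restrict).congr ?_
      filter_upwards [ae_restrict_mem (s.measurableSet_preimage _)] with x hx
      have hx' : s x = c := hx
      rw [hx']
    · exact ((hA.2 x).tendsto _).comp (hw.tendsto_approx x)
  refine h1.congr ?_
  filter_upwards [hu.ae_eq_mk, hg.ae_eq_mk] with x h1 h2
  rw [h1, h2]

/-- Since `p` is bounded, the scaling by `μ` costs at most the factor `max 1 μ ^ p⁺`. -/
theorem MemLpVarLoc.locallyIntegrable_rpow (hp : IsExponent p) {g : E n → E n}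
    (hg : MemLpVarLoc p g) : LocallyIntegrable fun x => ‖g x‖ ^ p x := by
  rw [locallyIntegrable_iff]
  intro K hK
  obtain ⟨hm, μ, hμ, hfin⟩ := hg K hK
  have hm' : ∀ c : ℝ, AEStronglyMeasurable (fun x => (‖g x‖ / c) ^ p x) (volume.restrict K) :=
    fun c => (((hm.norm.aemeasurable.div_const c)).pow
      hp.continuous.measurable.aemeasurable).aestronglyMeasurable
  have h1 : IntegrableOn (fun x => (‖g x‖ / μ) ^ p x) K := by
    refine ⟨hm' μ, ?_⟩
    rw [hasFiniteIntegral_iff_ofReal (Eventually.of_forall fun x => by positivity)]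
    exact hfin
  refine Integrable.mono' (h1.const_mul ((max 1 μ) ^ pPlus p)) (by simpa using hm' 1)
    (Eventually.of_forall fun x => ?_)
  rw [Real.norm_of_nonneg (by positivity)]
  calc ‖g x‖ ^ p x = μ ^ p x * (‖g x‖ / μ) ^ p x := by
        rw [← Real.mul_rpow hμ.le (by positivity), mul_div_cancel₀ _ hμ.ne']
    _ ≤ max 1 μ ^ pPlus p * (‖g x‖ / μ) ^ p x := by
        gcongr
        exact (Real.rpow_le_rpow hμ.le (le_max_right _ _) (hp.pos x).le).trans
          (Real.rpow_le_rpow_of_exponent_le (le_max_left _ _) (hp.le_pPlus x))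

/-- A one-sided form of the generalized dominated convergence theorem. -/
theorem integral_nonpos_of_tendsto_of_dominated {α : Type*} [MeasurableSpace α] {μ : Measure α}
    {F D : ℕ → α → ℝ} {F₀ D₀ : α → ℝ} (hF : ∀ i, AEStronglyMeasurable (F i) μ)
    (hD : ∀ i, Integrable (D i) μ) (hD₀ : Integrable D₀ μ)
    (hFD : ∀ i, ∀ᵐ x ∂μ, |F i x| ≤ D i x)
    (hFl : ∀ᵐ x ∂μ, Tendsto (fun i => F i x) atTop (𝓝 (F₀ x)))
    (hDl : ∀ᵐ x ∂μ, Tendsto (fun i => D i x) atTop (𝓝 (D₀ x)))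
    (hDint : ∀ i, ∫ x, D i x ∂μ = ∫ x, D₀ x ∂μ) (hneg : ∀ i, ∫ x, F i x ∂μ ≤ 0) :
    Integrable F₀ μ ∧ ∫ x, F₀ x ∂μ ≤ 0 := by
  have hFi : ∀ i, Integrable (F i) μ := fun i => (hD i).mono' (hF i) (hFD i)
  have hFD' : ∀ᵐ x ∂μ, ∀ i, |F i x| ≤ D i x := ae_all_iff.2 hFD
  have hF₀D : ∀ᵐ x ∂μ, |F₀ x| ≤ D₀ x := by
    filter_upwards [hFl, hDl, hFD'] with x h1 h2 h3
    exact le_of_tendsto_of_tendsto' h1.abs h2 h3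
  have hF₀ : Integrable F₀ μ :=
    hD₀.mono' (aestronglyMeasurable_of_tendsto_ae atTop hF hFl) hF₀D
  have hFDi : ∀ i, Integrable (fun x => F i x + D i x) μ := fun i => (hFi i).add (hD i)
  have hFD₀ : Integrable (fun x => F₀ x + D₀ x) μ := hF₀.add hD₀
  -- Fatou's lemma for the nonnegative functions `F i + D i`, whose integrals are at most that of
  -- `D₀`.
  have h1 : ∫⁻ x, ENNReal.ofReal (F₀ x + D₀ x) ∂μ ≤ ENNReal.ofReal (∫ x, D₀ x ∂μ) := calc
    ∫⁻ x, ENNReal.ofReal (F₀ x + D₀ x) ∂μ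
        = ∫⁻ x, liminf (fun i => ENNReal.ofReal (F i x + D i x)) atTop ∂μ := by
      refine lintegral_congr_ae ?_
      filter_upwards [hFl, hDl] with x h1 h2
      exact ((ENNReal.tendsto_ofReal (h1.add h2)).liminf_eq).symm
    _ ≤ liminf (fun i => ∫⁻ x, ENNReal.ofReal (F i x + D i x) ∂μ) atTop :=
      lintegral_liminf_le' fun i => (hFDi i).aemeasurable.ennreal_ofReal
    _ ≤ ENNReal.ofReal (∫ x, D₀ x ∂μ) := by
      refine liminf_le_of_frequently_le' (Frequently.of_forall fun i => ?_)
      rw [← ofReal_integral_eq_lintegral_ofReal (hFDi i)]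
      · refine ENNReal.ofReal_le_ofReal ?_
        rw [integral_add (hFi i) (hD i), hDint i]
        linarith [hneg i]
      · filter_upwards [hFD i] with x hx
        have := neg_le_of_abs_le hx
        simp only [Pi.zero_apply]
        linarith
  rw [← ofReal_integral_eq_lintegral_ofReal hFD₀ (by
    filter_upwards [hF₀D] with x hx
    have := neg_le_of_abs_le hx
    simp only [Pi.zero_apply]
    linarith)] at h1
  have h0 : 0 ≤ ∫ x, D₀ x ∂μ := integral_nonneg_of_ae (by
    filter_upwards [hF₀D] with x hx
    exact (abs_nonneg _).trans hx)
  have h2 := (ENNReal.ofReal_le_ofReal_iff h0).1 h1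
  rw [integral_add hF₀ hD₀] at h2
  exact ⟨hF₀, by linarith⟩

/-! ### Mollification -/

section Mollify

variable {F : Type*} [NormedAddCommGroup F] [NormedSpace ℝ F]

/-- The mollification of `g` by a normed bump function. -/
noncomputable def mollify (φ : ContDiffBump (0 : E n)) (g : E n → F) : E n → F :=
  convolution (φ.normed volume) g (ContinuousLinearMap.lsmul ℝ ℝ) volume

variable (φ : ContDiffBump (0 : E n))

theorem mollify_apply (g : E n → F) (x : E n) :
    mollify φ g x = ∫ y, φ.normed volume (x - y) • g y :=
  convolution_lsmul_swap

theorem hasCompactSupport_normed_sub (x : E n) :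
    HasCompactSupport fun y => φ.normed volume (x - y) :=
  φ.hasCompactSupport_normed.comp_homeomorph (Homeomorph.subLeft x)

theorem isTest_normed_sub (x : E n) : IsTest fun y => φ.normed volume (x - y) :=
  ⟨φ.contDiff_normed.comp (contDiff_const.sub contDiff_id), hasCompactSupport_normed_sub φ x⟩

theorem integrable_normed_sub_smul {g : E n → F} (hg : LocallyIntegrable g) (x : E n) :
    Integrable fun y => φ.normed volume (x - y) • g y :=
  hg.integrable_smul_left_of_hasCompactSupport (isTest_normed_sub φ x).1.continuous
    (hasCompactSupport_normed_sub φ x)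

theorem integral_normed_sub (x : E n) : ∫ y, φ.normed volume (x - y) = 1 := by
  rw [integral_sub_left_eq_self (fun y => φ.normed volume y) volume x]
  exact φ.integral_normed

theorem contDiff_mollify {g : E n → F} (hg : LocallyIntegrable g) : ContDiff ℝ ∞ (mollify φ g) :=
  φ.hasCompactSupport_normed.contDiff_convolution_left _ φ.contDiff_normed hg

theorem mollify_nonneg {u : E n → ℝ} (hu : ∀ᵐ x, 0 ≤ u x) (x : E n) : 0 ≤ mollify φ u x := by
  rw [mollify_apply]
  refine integral_nonneg_of_ae ?_
  filter_upwards [hu] with y hy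
  exact mul_nonneg (φ.nonneg_normed _) hy

theorem integrable_mollify {H : E n → ℝ} (hH : Integrable H) : Integrable (mollify φ H) :=
  φ.integrable_normed.integrable_convolution _ hH

theorem integral_mollify {H : E n → ℝ} (hH : Integrable H) :
    ∫ x, mollify φ H x = ∫ x, H x := by
  unfold mollify
  rw [integral_convolution _ φ.integrable_normed hH, φ.integral_normed]
  simp

/-- Differentiate the kernel and use `y ↦ ρ(x - y)` as test function; the sign from the inner
derivative cancels that of the integration by parts. -/
theorem HasWeakGradient.gradient_mollify {u : E n → ℝ} {g : E n → E n} (h : HasWeakGradient u g)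
    (x : E n) : gradient (mollify φ u) x = mollify φ g x := by
  obtain ⟨hu, hg, hw⟩ := h
  have hρ : ContDiff ℝ 1 (φ.normed volume) := φ.contDiff_normed (n := 1)
  have hd := φ.hasCompactSupport_normed.hasFDerivAt_convolution_left
    (ContinuousLinearMap.lsmul ℝ ℝ) hρ hu x
  refine ext_inner_right ℝ fun v => ?_
  have hint := (φ.hasCompactSupport_normed (μ := (volume : Measure (E n)))).fderiv
    (𝕜 := ℝ) |>.convolutionExists_left
    (ContinuousLinearMap.precompL (E n) (ContinuousLinearMap.lsmul ℝ ℝ))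
    (hρ.continuous_fderiv one_ne_zero) hu x
  have e1 : inner ℝ (gradient (mollify φ u) x) v
      = ∫ y, fderiv ℝ (φ.normed volume) (x - y) v * u y := by
    rw [inner_gradient_left]
    unfold mollify
    rw [hd.fderiv, convolution_eq_swap, ContinuousLinearMap.integral_apply hint.integrable_swap]
    rfl
  have e2 : inner ℝ (mollify φ g x) v = ∫ y, inner ℝ (φ.normed volume (x - y) • g y) v := by
    rw [mollify_apply, real_inner_comm, ← integral_inner (integrable_normed_sub_smul φ hg x) v]
    simp_rw [real_inner_comm v]
  have h1 := congrArg (fun w => inner ℝ v w) (hw _ (isTest_normed_sub φ x))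
  have hgr : ∀ y, inner ℝ v (gradient (fun y => φ.normed volume (x - y)) y)
      = - fderiv ℝ (φ.normed volume) (x - y) v := fun y => by
    rw [real_inner_comm, inner_gradient_left]
    have h2 : HasFDerivAt (fun y => φ.normed volume (x - y))
        ((fderiv ℝ (φ.normed volume) (x - y)).comp (-ContinuousLinearMap.id ℝ (E n))) y :=
      ((hρ.differentiable one_ne_zero (x - y)).hasFDerivAt).comp y ((hasFDerivAt_id y).const_sub x)
    rw [h2.fderiv]
    simp
  have hi : Integrable fun y => u y • gradient (fun y => φ.normed volume (x - y)) y := by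
    have ht := isTest_normed_sub φ x
    have hgc : Continuous (gradient fun y => φ.normed volume (x - y)) :=
      (InnerProductSpace.toDual ℝ (E n)).symm.continuous.comp
        (ht.1.continuous_fderiv (by simp))
    refine hu.integrable_smul_right_of_hasCompactSupport hgc ?_
    exact (ht.2.fderiv (𝕜 := ℝ)).comp_left (map_zero _)
  simp only [inner_neg_right] at h1
  rw [← integral_inner hi, ← integral_inner (integrable_normed_sub_smul φ hg x)] at h1
  rw [e1, e2]
  simp_rw [real_inner_comm v]
  simp only [inner_smul_right, hgr] at h1 ⊢
  rw [← neg_inj, ← h1, ← integral_neg]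
  congr 1
  ext y
  ring

end Mollify

/-- The mollification estimate behind the density of smooth functions: for a log-Hölder continuous
exponent, `|g * ρ|^p` is controlled by `(|g|^p + 1) * ρ`, uniformly in the mollifier. -/
theorem exists_norm_mollify_rpow_le (hp : IsExponent p) {g : E n → E n}
    (hg : LocallyIntegrable g) {H : E n → ℝ} (hH : Integrable H) (hH0 : ∀ x, 0 ≤ H x) (R : ℝ)
    (hHg : ∀ x ∈ Metric.closedBall (0 : E n) (R + 1), ‖g x‖ ^ p x + 1 ≤ H x) :
    ∃ C : ℝ, 0 ≤ C ∧ ∀ φ : ContDiffBump (0 : E n), φ.rOut ≤ 1 → φ.rOut ≤ 2 * φ.rIn →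
      ∀ x ∈ Metric.closedBall (0 : E n) R, ‖mollify φ g x‖ ^ p x ≤ C * mollify φ H x := by
  obtain ⟨L, hL0, hL⟩ := hp.logHolder.exists_bound
  set P := pPlus p
  have hP : 0 < P := hp.pPlus_pos
  set v := (volume : Measure (E n)).real (Metric.ball (0 : E n) 1)
  have hv0 : 0 < v := 
    ENNReal.toReal_pos (Metric.measure_ball_pos _ _ one_pos).ne' measure_ball_lt_top.ne
  set I := ∫ x, H x
  set Λ := max 1 (2 ^ n / v * I)
  set C₀ := Real.exp (P * L * (Real.log Λ + n))
  have hC₀ : 0 < C₀ := Real.exp_pos _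
  refine ⟨(1 + C₀) ^ P, by positivity, fun φ hφ1 hφ2 x hx => ?_⟩
  set ε := φ.rOut
  have hε : 0 < ε := φ.rOut_pos
  set ρ : E n → ℝ := fun y => φ.normed volume (x - y) with hρ
  have hρ0 : ∀ y, 0 ≤ ρ y := fun y => φ.nonneg_normed _
  have hρi : Integrable ρ := by
    simpa using integrable_normed_sub_smul φ (locallyIntegrable_const (1 : ℝ)) x
  have hρH : Integrable fun y => ρ y * H y :=
    integrable_normed_sub_smul φ hH.locallyIntegrable x
  have hsupp : ∀ y, ρ y ≠ 0 → dist x y ≤ ε := fun y hy => by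
    have : x - y ∈ Function.support (φ.normed volume) := hy
    rw [φ.support_normed_eq, mem_ball_zero_iff] at this
    rw [dist_eq_norm]
    exact this.le
  have hmem : ∀ y, ρ y ≠ 0 → ‖g y‖ ^ p y + 1 ≤ H y := fun y hy => by
    refine hHg y ?_
    rw [mem_closedBall_zero_iff] at hx ⊢
    have h1 := hsupp y hy
    rw [dist_comm, dist_eq_norm] at h1
    have h2 := norm_add_le (y - x) x
    rw [sub_add_cancel] at h2
    linarith
  set S := mollify φ H x
  have hS : S = ∫ y, ρ y * H y := mollify_apply φ H x
  -- This is the purpose of the summand `1` in the lower bound for `H`: on the support of `ρ` one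
  -- has `H ≥ 1`.
  have hS1 : 1 ≤ S := by
    rw [hS, ← integral_normed_sub φ x]
    refine integral_mono hρi hρH fun y => ?_
    by_cases hy : ρ y = 0
    · simp only [hρ] at hy
      simp [hρ, hy]
    · have h1 := hmem y hy
      have h2 : 0 ≤ ‖g y‖ ^ p y := by positivity
      exact le_mul_of_one_le_right (hρ0 y) (by linarith)
  -- As the inner radius is at least `ε / 2`, the kernel is at most `2 ^ n` over the volume of the
  -- ball of radius `ε`.
  have hSΛ : S ≤ Λ / ε ^ n := by
    have hb : ∀ y, ρ y ≤ 2 ^ n / (ε ^ n * v) := fun y => by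
      have := φ.normed_le_div_measure_closedBall_rOut volume 2 hφ2 (x - y)
      rwa [Measure.addHaar_real_closedBall _ _ hε.le, finrank_euclideanSpace_fin] at this
    calc S = ∫ y, ρ y * H y := hS
      _ ≤ ∫ y, 2 ^ n / (ε ^ n * v) * H y :=
        integral_mono hρH (hH.const_mul _) fun y => mul_le_mul_of_nonneg_right (hb y) (hH0 y)
      _ = (2 ^ n / v * I) / ε ^ n := by rw [integral_const_mul]; change _ * I = _; field_simp
      _ ≤ Λ / ε ^ n := by gcongr; exact le_max_right _ _
  have hS0 : 0 < S := by linarith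
  have hpx := hp.pos x
  -- Log-Hölder continuity enters here: `S` grows at most polynomially in `1 / ε`, while the
  -- exponent is `O(1 / log (1 / ε))`. So `p y` may be exchanged for `p x`.
  have hpow : ∀ y, dist x y ≤ ε → S ^ (1 - p y / p x) ≤ C₀ := fun y hy => by
    have hpy := hp.pos y
    have h1 : 1 - p y / p x ≤ P * L / Real.log (Real.exp 1 + 1 / ε) := by
      have h2 := (abs_le.1 (hL ε hε x y hy)).1
      have h3 : 1 - p y / p x = p y * -(1 / p x - 1 / p y) := by field_simp; ring
      have h4 : -(1 / p x - 1 / p y) ≤ L / Real.log (Real.exp 1 + 1 / ε) := by linarith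
      have h5 : 0 ≤ L / Real.log (Real.exp 1 + 1 / ε) :=
        (abs_nonneg _).trans (hL ε hε x x (by simpa using hε.le))
      rw [h3, mul_div_assoc]
      exact (mul_le_mul_of_nonneg_left h4 hpy.le).trans
        (mul_le_mul_of_nonneg_right (hp.le_pPlus y) h5)
    exact (Real.rpow_le_rpow_of_exponent_le hS1 h1).trans
      (rpow_div_log_le n (by positivity) hS1 (le_max_left _ _) hε hSΛ)
  -- The target size of the mollified field, used as a threshold: where `|g| > lam`, `p y ≥ 1` gives
  -- `|g| / lam ≤ (|g| / lam) ^ p y`, which is at most `C₀ H / S`.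
  set lam := S ^ (1 / p x) with hlam
  have hlam0 : 0 < lam := Real.rpow_pos_of_pos hS0 _
  have hpt : ∀ y, ‖ρ y • g y‖ ≤ lam * ρ y + lam * C₀ / S * (ρ y * H y) := fun y => by
    rw [norm_smul, Real.norm_of_nonneg (hρ0 y)]
    by_cases hy : ρ y = 0
    · simp [hy]
    have hH' := hmem y hy
    have hk : ‖g y‖ ≤ lam + lam * C₀ / S * H y := by
      have hH1 : 0 ≤ lam * C₀ / S * H y := by have := hH0 y; positivity
      rcases le_total ‖g y‖ lam with h | h
      · linarith
      have h1 : 1 ≤ ‖g y‖ / lam := by rwa [one_le_div hlam0]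
      have h2 : ‖g y‖ / lam ≤ (‖g y‖ / lam) ^ p y := Real.self_le_rpow_of_one_le h1 (hp.one_le y)
      have h3 : (‖g y‖ / lam) ^ p y = ‖g y‖ ^ p y * S ^ (1 - p y / p x) / S := by
        rw [Real.div_rpow (norm_nonneg _) hlam0.le, hlam, ← Real.rpow_mul hS0.le,
          Real.rpow_sub hS0, Real.rpow_one, one_div_mul_eq_div]
        field_simp
      have h4 : ‖g y‖ ^ p y * S ^ (1 - p y / p x) / S ≤ H y * C₀ / S := by
        gcongr
        · exact hH0 y
        · linarith
        · exact hpow y (hsupp y hy)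
      have h5 : ‖g y‖ / lam ≤ H y * C₀ / S := by linarith
      rw [div_le_iff₀ hlam0] at h5
      calc ‖g y‖ ≤ H y * C₀ / S * lam := h5
        _ = lam * C₀ / S * H y := by ring
        _ ≤ _ := by linarith
    calc ρ y * ‖g y‖ ≤ ρ y * (lam + lam * C₀ / S * H y) := mul_le_mul_of_nonneg_left hk (hρ0 y)
      _ = _ := by ring
  have hn : ‖mollify φ g x‖ ≤ lam * (1 + C₀) := calc
    ‖mollify φ g x‖ = ‖∫ y, ρ y • g y‖ := by rw [mollify_apply]
    _ ≤ ∫ y, ‖ρ y • g y‖ := norm_integral_le_integral_norm _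
    _ ≤ ∫ y, (lam * ρ y + lam * C₀ / S * (ρ y * H y)) :=
      integral_mono (integrable_normed_sub_smul φ hg x).norm
        ((hρi.const_mul _).add (hρH.const_mul _)) hpt
    _ = lam * (1 + C₀) := by
      rw [integral_add (hρi.const_mul _) (hρH.const_mul _), integral_const_mul,
        integral_const_mul, ← hS, integral_normed_sub φ x]
      field_simp
  calc ‖mollify φ g x‖ ^ p x ≤ (lam * (1 + C₀)) ^ p x :=
        Real.rpow_le_rpow (norm_nonneg _) hn hpx.le
    _ = (1 + C₀) ^ p x * S := by
      rw [Real.mul_rpow hlam0.le (by positivity), hlam, ← Real.rpow_mul hS0.le,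
        one_div_mul_cancel hpx.ne', Real.rpow_one, mul_comm]
    _ ≤ (1 + C₀) ^ P * S := by
      gcongr
      · linarith
      · exact hp.le_pPlus x

/-- A sequence of bump functions shrinking to the origin. -/
noncomputable def shrinkingBump (n : ℕ) (i : ℕ) : ContDiffBump (0 : E n) where
  rIn := 1 / (2 * (i + 1))
  rOut := 1 / (i + 1)
  rIn_pos := by positivity
  rIn_lt_rOut := by
    have := (Nat.cast_nonneg i : (0 : ℝ) ≤ i)
    exact one_div_lt_one_div_of_lt (by positivity) (by linarith)

theorem shrinkingBump_rOut_le_one (i : ℕ) : (shrinkingBump n i).rOut ≤ 1 := by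
  change (1 : ℝ) / (i + 1) ≤ 1
  rw [div_le_one (by positivity)]
  linarith [(Nat.cast_nonneg i : (0 : ℝ) ≤ i)]

theorem shrinkingBump_rOut_le (i : ℕ) : (shrinkingBump n i).rOut ≤ 2 * (shrinkingBump n i).rIn := by
  change (1 : ℝ) / (i + 1) ≤ 2 * (1 / (2 * (i + 1)))
  apply le_of_eq
  field_simp

theorem tendsto_mollify_shrinkingBump {F : Type*} [NormedAddCommGroup F] [NormedSpace ℝ F]
    [CompleteSpace F] {g : E n → F} (hg : LocallyIntegrable g) :
    ∀ᵐ x, Tendsto (fun i => mollify (shrinkingBump n i) g x) atTop (𝓝 (g x)) :=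
  ContDiffBump.ae_convolution_tendsto_right_of_locallyIntegrable (K := 2)
    tendsto_one_div_add_atTop_nhds_zero_nat (Eventually.of_forall shrinkingBump_rOut_le) hg

/-! ### Nonsmooth test functions -/

theorem IsTest.continuous_gradient {φ : E n → ℝ} (h : IsTest φ) : Continuous (gradient φ) :=
  (InnerProductSpace.toDual ℝ (E n)).symm.continuous.comp (h.1.continuous_fderiv (by simp))

theorem IsTest.hasCompactSupport_gradient {φ : E n → ℝ} (h : IsTest φ) :
    HasCompactSupport (gradient φ) :=
  (h.2.fderiv (𝕜 := ℝ)).comp_left (map_zero _)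

theorem gradient_eq_zero_of_notMem_tsupport {φ : E n → ℝ} {x : E n} (hx : x ∉ tsupport φ) :
    gradient φ x = 0 := by
  have : fderiv ℝ φ x = 0 := by
    by_contra h
    exact hx (support_fderiv_subset ℝ h)
  simp [gradient, this]

theorem gradient_comp_mul {Ψ : ℝ → ℝ} {w ζ : E n → ℝ} {x : E n}
    (hΨ : DifferentiableAt ℝ Ψ (w x)) (hw : DifferentiableAt ℝ w x) (hζ : DifferentiableAt ℝ ζ x) :
    gradient (fun y => Ψ (w y) * ζ y) x
      = (deriv Ψ (w x) * ζ x) • gradient w x + Ψ (w x) • gradient ζ x := by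
  refine ext_inner_right ℝ fun v => ?_
  have h := (hΨ.hasDerivAt.comp_hasFDerivAt x hw.hasFDerivAt).mul hζ.hasFDerivAt
  have h' : HasFDerivAt (fun y => Ψ (w y) * ζ y) _ x := h
  rw [inner_gradient_left, h'.fderiv, inner_add_left, real_inner_smul_left, real_inner_smul_left,
    inner_gradient_left, inner_gradient_left]
  simp only [Function.comp_apply, add_apply, smul_apply, smul_eq_mul]
  ring

/-- A distributional inequality `div V ≥ 0` may be tested with `Ψ(u) ζ`, where `u` is in the
Sobolev class of which the growth of `V` is controlled. -/
theorem integrable_and_integral_nonpos_of_comp_mul (hp : IsExponent p) {u : E n → ℝ}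
    {g V : E n → E n} (hug : HasWeakGradient u g) (hu0 : ∀ᵐ x, 0 ≤ u x)
    (hgp : LocallyIntegrable fun x => ‖g x‖ ^ p x) (hV : AEStronglyMeasurable V)
    {b : ℝ} (hb : 0 ≤ b) (hVb : ∀ x, ‖V x‖ ≤ b * ‖g x‖ ^ (p x - 1))
    (hdiv : ∀ φ : E n → ℝ, IsTest φ → (∀ x, 0 ≤ φ x) → ∫ x, inner ℝ (V x) (gradient φ x) ≤ 0)
    {Ψ : ℝ → ℝ} (hΨ : ContDiff ℝ ∞ Ψ) (hΨ0 : ∀ t, 0 ≤ t → 0 ≤ Ψ t) {B : ℝ} (hB : ∀ t, |Ψ t| ≤ B)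
    (hB' : ∀ t, |deriv Ψ t| ≤ B) {ζ : E n → ℝ} (hζ : IsTest ζ) (hζ0 : ∀ x, 0 ≤ ζ x) :
    (Integrable fun x => deriv Ψ (u x) * ζ x * inner ℝ (V x) (g x)
        + Ψ (u x) * inner ℝ (V x) (gradient ζ x)) ∧
      ∫ x, (deriv Ψ (u x) * ζ x * inner ℝ (V x) (g x)
        + Ψ (u x) * inner ℝ (V x) (gradient ζ x)) ≤ 0 := by
  have hB0 : 0 ≤ B := (abs_nonneg _).trans (hB 0)
  obtain ⟨Z, hZ⟩ := hζ.2.exists_bound_of_continuous hζ.1.continuous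
  obtain ⟨Z', hZ'⟩ := hζ.hasCompactSupport_gradient.exists_bound_of_continuous
    hζ.continuous_gradient
  have hZ0 : 0 ≤ Z := (norm_nonneg _).trans (hZ 0)
  have hZ0' : 0 ≤ Z' := (norm_nonneg _).trans (hZ' 0)
  obtain ⟨R, hR⟩ := hζ.2.isCompact.isBounded.subset_closedBall 0
  -- The margin `1` in the radius contains every mollifier centred on the support of `ζ`.
  set H : E n → ℝ := (Metric.closedBall (0 : E n) (R + 1)).indicator fun x => ‖g x‖ ^ p x + 1
    with hHdef
  have hH0 : ∀ x, 0 ≤ H x := fun x => indicator_nonneg (fun y _ => by positivity) x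
  have hH : Integrable H := by
    rw [hHdef, integrable_indicator_iff Metric.isClosed_closedBall.measurableSet]
    exact (hgp.integrableOn_isCompact (isCompact_closedBall _ _)).add
      (integrableOn_const measure_closedBall_lt_top.ne)
  have hHg : ∀ x ∈ Metric.closedBall (0 : E n) (R + 1), ‖g x‖ ^ p x + 1 ≤ H x := fun x hx => by
    rw [hHdef, indicator_of_mem hx]
  obtain ⟨C, hC0, hC⟩ := exists_norm_mollify_rpow_le hp hug.2.1 hH hH0 R hHg
  set K := b * B * (Z + Z') * (1 + C)
  have hK : 0 ≤ K := by positivity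
  set w : ℕ → E n → ℝ := fun i => mollify (shrinkingBump n i) u
  have hw : ∀ i, ContDiff ℝ ∞ (w i) := fun i => contDiff_mollify _ hug.1
  have hgw : ∀ i x, gradient (fun y => Ψ (w i y) * ζ y) x
      = (deriv Ψ (w i x) * ζ x) • mollify (shrinkingBump n i) g x
        + Ψ (w i x) • gradient ζ x := fun i x => by
    rw [gradient_comp_mul ((hΨ.differentiable (by simp)) _) ((hw i).differentiable (by simp) x)
      (hζ.1.differentiable (by simp) x), hug.gradient_mollify]
  have htest : ∀ i, IsTest fun y => Ψ (w i y) * ζ y := fun i =>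
    ⟨(hΨ.comp (hw i)).mul hζ.1, hζ.2.mul_left⟩
  have hΨ' : Continuous (deriv Ψ) := hΨ.continuous_deriv (by simp)
  -- The majorants converge almost everywhere to `D₀` and all have its integral, because
  -- mollification preserves integrals.
  refine integral_nonpos_of_tendsto_of_dominated
    (F := fun i x => inner ℝ (V x) (gradient (fun y => Ψ (w i y) * ζ y) x))
    (D := fun i x => K * (H x + mollify (shrinkingBump n i) H x))
    (D₀ := fun x => K * (H x + H x))
    (fun i => hV.inner (htest i).continuous_gradient.aestronglyMeasurable)
    (fun i => (hH.add (integrable_mollify _ hH)).const_mul K) ((hH.add hH).const_mul K)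
    (fun i => Eventually.of_forall fun x => ?_) ?_ ?_ (fun i => ?_) (fun i => ?_)
  · have hS0 : 0 ≤ mollify (shrinkingBump n i) H x :=
      mollify_nonneg _ (Eventually.of_forall hH0) x
    have hHx := hH0 x
    by_cases hx : x ∈ tsupport ζ
    · have hxR := hR hx
      have h1 := hHg x (Metric.closedBall_subset_closedBall (by linarith) hxR)
      have h2 := hC _ (shrinkingBump_rOut_le_one i) (shrinkingBump_rOut_le i) x hxR
      rw [hgw]
      set γ := mollify (shrinkingBump n i) g x
      set S := mollify (shrinkingBump n i) H x
      have hgr : ‖(deriv Ψ (w i x) * ζ x) • γ + Ψ (w i x) • gradient ζ x‖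
          ≤ B * Z * ‖γ‖ + B * Z' := by
        refine (norm_add_le _ _).trans ?_
        rw [norm_smul, norm_smul, norm_mul]
        gcongr
        · exact hB' _
        · exact hZ x
        · exact hB _
        · exact hZ' x
      have h3 := rpow_sub_one_mul_le (norm_nonneg (g x)) (norm_nonneg γ) (hp.one_le x)
      have h4 := rpow_sub_one_mul_le (norm_nonneg (g x)) zero_le_one (hp.one_le x)
      rw [Real.one_rpow, mul_one] at h4
      have h5 : ‖g x‖ ^ (p x - 1) * (B * Z * ‖γ‖ + B * Z')
          ≤ B * Z * (H x + C * S) + B * Z' * H x := by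
        have e1 : B * Z * (‖g x‖ ^ (p x - 1) * ‖γ‖) ≤ B * Z * (H x + C * S) :=
          mul_le_mul_of_nonneg_left (by linarith) (by positivity)
        have e2 : B * Z' * ‖g x‖ ^ (p x - 1) ≤ B * Z' * H x :=
          mul_le_mul_of_nonneg_left (by linarith) (by positivity)
        linarith
      have h6 : B * Z * (H x + C * S) + B * Z' * H x ≤ B * (Z + Z') * (1 + C) * (H x + S) := by
        have : 0 ≤ B * Z * (C * H x + S) + B * Z' * (C * H x + (1 + C) * S) := by positivity
        linarith
      calc |inner ℝ (V x) _| ≤ ‖V x‖ * _ := abs_real_inner_le_norm _ _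
        _ ≤ (b * ‖g x‖ ^ (p x - 1)) * (B * Z * ‖γ‖ + B * Z') :=
          mul_le_mul (hVb x) hgr (norm_nonneg _) (by positivity)
        _ = b * (‖g x‖ ^ (p x - 1) * (B * Z * ‖γ‖ + B * Z')) := by ring
        _ ≤ b * (B * (Z + Z') * (1 + C) * (H x + S)) :=
          mul_le_mul_of_nonneg_left (h5.trans h6) hb
        _ = K * (H x + S) := by ring
    · rw [hgw, gradient_eq_zero_of_notMem_tsupport hx, image_eq_zero_of_notMem_tsupport hx]
      simp only [mul_zero, zero_smul, smul_zero, add_zero, inner_zero_right, abs_zero]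
      positivity
  · filter_upwards [tendsto_mollify_shrinkingBump hug.1, tendsto_mollify_shrinkingBump hug.2.1]
      with x h1 h2
    simp only [hgw, inner_add_right, inner_smul_right]
    have h3 : Tendsto (fun i => w i x) atTop (𝓝 (u x)) := h1
    exact ((((hΨ'.tendsto _).comp h3).mul_const _).mul (tendsto_const_nhds.inner h2)).add
      (((hΨ.continuous.tendsto _).comp h3).mul_const _)
  · filter_upwards [tendsto_mollify_shrinkingBump hH.locallyIntegrable] with x h1
    exact (tendsto_const_nhds.add h1).const_mul K
  · rw [integral_const_mul, integral_const_mul, integral_add hH hH,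
      integral_add hH (integrable_mollify _ hH), integral_mollify _ hH]
  · exact hdiv _ (htest i) fun x => mul_nonneg (hΨ0 _ (mollify_nonneg _ hu0 x)) (hζ0 x)

/-- A function with vanishing weak gradient is constant. -/
theorem HasWeakGradient.exists_ae_eq_const {u : E n → ℝ} {g : E n → E n} (h : HasWeakGradient u g)
    (hg : ∀ᵐ x, g x = 0) : ∃ c : ℝ, ∀ᵐ x, u x = c := by
  have hmg : ∀ φ : ContDiffBump (0 : E n), ∀ x, mollify φ g x = 0 := fun φ x => by
    rw [mollify_apply]
    refine integral_eq_zero_of_ae ?_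
    filter_upwards [hg] with y hy
    simp [hy]
  -- Each mollification has vanishing gradient, hence is constant, and `u` is their limit almost
  -- everywhere.
  have hc : ∀ i x, mollify (shrinkingBump n i) u x = mollify (shrinkingBump n i) u 0 := fun i x => by
    refine is_const_of_fderiv_eq_zero
      ((contDiff_mollify _ h.1).differentiable (by simp)) (fun y => ?_) x 0
    rw [← toDual_gradient, h.gradient_mollify, hmg, map_zero]
  have hl := tendsto_mollify_shrinkingBump h.1
  obtain ⟨x₀, hx₀⟩ := hl.exists
  refine ⟨u x₀, ?_⟩
  filter_upwards [hl] with x hx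
  simp only [hc _ x] at hx
  simp only [hc _ x₀] at hx₀
  exact tendsto_nhds_unique hx hx₀

/-! ### The Caccioppoli estimate -/

/-- Cutoff functions between balls of radius `R` and `2 R`, with gradient of order `1 / R`. -/
theorem exists_cutoff (n : ℕ) : ∃ c : ℝ, 0 ≤ c ∧ ∀ R : ℝ, 0 < R → ∃ η : E n → ℝ, IsTest η ∧
    (∀ x, 0 ≤ η x) ∧ (∀ x, η x ≤ 1) ∧ (∀ x, ‖x‖ ≤ R → η x = 1) ∧
    (∀ x, gradient η x ≠ 0 → R ≤ ‖x‖ ∧ ‖x‖ ≤ 2 * R) ∧ ∀ x, ‖gradient η x‖ ≤ c / R := by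
  let χ : ContDiffBump (0 : E n) := ⟨1, 2, one_pos, one_lt_two⟩
  have hχ : IsTest χ := ⟨χ.contDiff, χ.hasCompactSupport⟩
  obtain ⟨c, hc⟩ := hχ.hasCompactSupport_gradient.exists_bound_of_continuous hχ.continuous_gradient
  refine ⟨c, (norm_nonneg _).trans (hc 0), fun R hR => ?_⟩
  have hgrad : ∀ x, gradient (fun x => χ (R⁻¹ • x)) x = R⁻¹ • gradient χ (R⁻¹ • x) := fun x => by
    refine ext_inner_right ℝ fun v => ?_
    have h2 : HasFDerivAt (fun y => χ (R⁻¹ • y))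
        ((fderiv ℝ χ (R⁻¹ • x)).comp (R⁻¹ • ContinuousLinearMap.id ℝ (E n))) x :=
      ((hχ.1.differentiable (by simp) (R⁻¹ • x)).hasFDerivAt).comp x
        ((hasFDerivAt_id x).const_smul R⁻¹)
    rw [inner_gradient_left, h2.fderiv, real_inner_smul_left, inner_gradient_left]
    simp
  have hns : ∀ x : E n, ‖R⁻¹ • x‖ = ‖x‖ / R := fun x => by
    rw [norm_smul, Real.norm_of_nonneg (by positivity), inv_mul_eq_div]
  refine ⟨fun x => χ (R⁻¹ • x), ⟨hχ.1.comp (contDiff_id.const_smul R⁻¹),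
    hχ.2.comp_homeomorph (Homeomorph.smulOfNeZero R⁻¹ (inv_ne_zero hR.ne'))⟩,
    fun x => χ.nonneg, fun x => χ.le_one, fun x hx => ?_, fun x hx => ?_, fun x => ?_⟩
  · refine χ.one_of_mem_closedBall ?_
    rw [mem_closedBall_zero_iff, hns]
    exact (div_le_one hR).2 hx
  · rw [hgrad] at hx
    have hx' : gradient χ (R⁻¹ • x) ≠ 0 := fun h => hx (by rw [h, smul_zero])
    constructor
    · by_contra! h
      refine hx' ?_
      have hmem : R⁻¹ • x ∈ Metric.ball (0 : E n) χ.rIn := by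
        rw [mem_ball_zero_iff, hns]
        exact (div_lt_one hR).2 h
      have : fderiv ℝ χ (R⁻¹ • x) = 0 := by
        rw [(χ.eventuallyEq_one_of_mem_ball hmem).fderiv_eq]
        exact fderiv_const_apply 1
      simp [gradient, this]
    · by_contra! h
      refine hx' (gradient_eq_zero_of_notMem_tsupport ?_)
      rw [χ.tsupport_eq, mem_closedBall_zero_iff, hns, not_le]
      change 2 < _
      rwa [lt_div_iff₀ hR]
  · rw [hgrad, norm_smul, Real.norm_of_nonneg (by positivity), inv_mul_eq_div]
    gcongr
    exact hc _

theorem gradient_pow {η : E n → ℝ} {x : E n} (hη : DifferentiableAt ℝ η x) (m : ℕ) :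
    gradient (fun y => η y ^ (m + 1)) x = ((m + 1) * η x ^ m) • gradient η x := by
  refine ext_inner_right ℝ fun v => ?_
  rw [inner_gradient_left, (hη.hasFDerivAt.pow (m + 1)).fderiv, real_inner_smul_left,
    inner_gradient_left]
  simp

/-- A bounded increasing profile that is comparable to the identity on `[0, M]`. -/
theorem hasDerivAt_mul_arctan_div {M : ℝ} (hM : 0 < M) (t : ℝ) :
    HasDerivAt (fun t => M * Real.arctan (t / M)) (1 / (1 + (t / M) ^ 2)) t := by
  have h := (((hasDerivAt_id t).div_const M).arctan).const_mul M
  refine h.congr_deriv ?_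
  simp only [id]
  field_simp

theorem abs_mul_arctan_div_le {M : ℝ} (hM : 0 < M) (t : ℝ) :
    |M * Real.arctan (t / M)| ≤ 2 * M := by
  have h1 := Real.arctan_lt_pi_div_two (t / M)
  have h2 := Real.neg_pi_div_two_lt_arctan (t / M)
  have h3 := Real.pi_le_four
  rw [abs_mul, abs_of_pos hM, mul_comm]
  gcongr
  rw [abs_le]
  constructor <;> linarith

/-- The weighted energy of a nonnegative subsolution of growth `|x| ^ β` decays. -/
theorem exists_energy_bound (hp : IsExponent p) {u : E n → ℝ}
    {g V : E n → E n} (hug : HasWeakGradient u g) (hu0 : ∀ᵐ x, 0 ≤ u x)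
    (hgp : LocallyIntegrable fun x => ‖g x‖ ^ p x) (hV : AEStronglyMeasurable V)
    {a b : ℝ} (ha : 0 < a) (hb : 0 ≤ b) (hVa : ∀ x, a * ‖g x‖ ^ p x ≤ inner ℝ (V x) (g x))
    (hVb : ∀ x, ‖V x‖ ≤ b * ‖g x‖ ^ (p x - 1))
    (hdiv : ∀ φ : E n → ℝ, IsTest φ → (∀ x, 0 ≤ φ x) → ∫ x, inner ℝ (V x) (gradient φ x) ≤ 0)
    {K β : ℝ} (hK : 1 ≤ K) (hβ0 : 0 ≤ β) (hβ1 : β ≤ 1)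
    (hgr : ∀ R : ℝ, 1 ≤ R → ∀ᵐ x, R ≤ ‖x‖ → ‖x‖ ≤ 2 * R → u x ≤ K * R ^ β) :
    ∃ T : ℝ, 0 ≤ T ∧ ∀ R : ℝ, 1 ≤ R → ∀ r : ℝ, r ≤ R →
      ∫ x in Metric.closedBall (0 : E n) r, ‖g x‖ ^ p x / (1 + u x ^ 2)
        ≤ T * R ^ (n + (β - 1) * pMinus p) := by
  obtain ⟨c, hc0, hcut⟩ := exists_cutoff n
  obtain ⟨m, hm⟩ := exists_nat_ge (pPlus p)
  -- With `Ψ'(u) ≥ 1/2` on the annulus, `δ = (a / 2) · (1 / 2)` lets Young's first term be absorbed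
  -- by half of the coercive term.
  set δ := a / 4 with hδdef
  have hδ : 0 < δ := by positivity
  -- The coefficient of the cross term is `t₀ R ^ (β - 1)`: `2M` bounds `Ψ`, and `c / R` bounds
  -- `∇η`.
  set t₀ := 2 * b * c * (m + 1) * K
  have ht₀ : 0 ≤ t₀ := by positivity
  set v := (volume : Measure (E n)).real (Metric.ball (0 : E n) 1)
  set T₁ := δ * max 1 (t₀ / δ) ^ pPlus p with hT₁
  have hT₁0 : 0 ≤ T₁ := by positivity
  refine ⟨2 / a * (T₁ * (2 ^ n * v)), by positivity, fun R hR r hr => ?_⟩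
  have hR0 : 0 < R := by linarith
  obtain ⟨η, hη, hη0, hη1, hηR, hηs, hηg⟩ := hcut R hR0
  set M := K * R ^ β with hM
  have hRβ : 1 ≤ R ^ β := Real.one_le_rpow hR hβ0
  have hM1 : 1 ≤ M := one_le_mul_of_one_le_of_one_le hK hRβ
  have hM0 : 0 < M := by linarith
  set Ψ : ℝ → ℝ := fun t => M * Real.arctan (t / M)
  have hdΨ : ∀ t, deriv Ψ t = 1 / (1 + (t / M) ^ 2) := fun t =>
    (hasDerivAt_mul_arctan_div hM0 t).deriv
  have hζ : IsTest fun x => η x ^ (m + 1) := ⟨hη.1.pow _, by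
    simpa [Function.comp_def] using hη.2.comp_left (g := fun t : ℝ => t ^ (m + 1)) (by simp)⟩
  obtain ⟨hGi, hG⟩ := integrable_and_integral_nonpos_of_comp_mul hp hug hu0 hgp hV hb hVb hdiv
    (Ψ := Ψ) (contDiff_const.mul (Real.contDiff_arctan.comp (contDiff_id.div_const M)))
    (fun t ht => mul_nonneg hM0.le (Real.arctan_nonneg.2 (by positivity)))
    (B := 2 * M) (abs_mul_arctan_div_le hM0) (fun t => by
      rw [hdΨ, abs_of_nonneg (by positivity)]
      have : 1 / (1 + (t / M) ^ 2) ≤ 1 :=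
        (div_le_one (by positivity)).2 (by nlinarith [sq_nonneg (t / M)])
      linarith)
    hζ (fun x => pow_nonneg (hη0 x) _)
  set G : E n → ℝ := fun x => deriv Ψ (u x) * η x ^ (m + 1) * inner ℝ (V x) (g x)
        + Ψ (u x) * inner ℝ (V x) (gradient (fun x => η x ^ (m + 1)) x)
  set τ := T₁ * R ^ ((β - 1) * pMinus p) with hτ
  have hτ0 : 0 ≤ τ := by positivity
  set J : E n → ℝ := (Metric.closedBall (0 : E n) (2 * R)).indicator fun _ => τ with hJ
  have hJi : Integrable J :=
    (integrable_indicator_iff Metric.isClosed_closedBall.measurableSet).2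
      (integrableOn_const measure_closedBall_lt_top.ne)
  have hkey : ∀ᵐ x, a / 2 * (1 / (1 + (u x / M) ^ 2) * η x ^ (m + 1) * ‖g x‖ ^ p x)
      ≤ G x + J x := by
    filter_upwards [hgr R hR, hu0] with x hx hux
    set θ := 1 / (1 + (u x / M) ^ 2) with hθ
    have hθ0 : 0 ≤ θ := by positivity
    have hζx : 0 ≤ η x ^ (m + 1) := pow_nonneg (hη0 x) _
    have hgx : 0 ≤ ‖g x‖ ^ p x := by positivity
    have hGx : G x = θ * η x ^ (m + 1) * inner ℝ (V x) (g x)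
        + Ψ (u x) * ((m + 1) * η x ^ m * inner ℝ (V x) (gradient η x)) := by
      simp only [G, hdΨ]
      rw [gradient_pow (hη.1.differentiable (by simp) x), inner_smul_right]
    have h1 : θ * η x ^ (m + 1) * (a * ‖g x‖ ^ p x) ≤ θ * η x ^ (m + 1) * inner ℝ (V x) (g x) :=
      mul_le_mul_of_nonneg_left (hVa x) (by positivity)
    have hpos : 0 ≤ θ * η x ^ (m + 1) * (a * ‖g x‖ ^ p x) := by positivity
    -- Only where `∇η ≠ 0`, thus in the annulus, is there a cross term, and only there is `u ≤ M`
    -- known.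
    by_cases h0 : gradient η x = 0
    · have hJ0 : 0 ≤ J x := indicator_nonneg (fun _ _ => hτ0) x
      rw [hGx, h0, inner_zero_right, mul_zero, mul_zero]
      linarith
    obtain ⟨hx1, hx2⟩ := hηs x h0
    have hJx : J x = τ := indicator_of_mem (mem_closedBall_zero_iff.2 hx2) _
    have huM : u x / M ≤ 1 := (div_le_one hM0).2 (hx hx1 hx2)
    have hθ2 : 1 / 2 ≤ θ := by
      have : 0 ≤ u x / M := by positivity
      apply one_div_le_one_div_of_le (by positivity)
      nlinarith
    set t := 2 * M * ((m + 1) * (b * (c / R))) with htdef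
    have ht0 : 0 ≤ t := by positivity
    have h2 : |Ψ (u x) * ((m + 1) * η x ^ m * inner ℝ (V x) (gradient η x))|
        ≤ t * (‖g x‖ ^ (p x - 1) * η x ^ m) := by
      have e : |inner ℝ (V x) (gradient η x)| ≤ b * ‖g x‖ ^ (p x - 1) * (c / R) :=
        (abs_real_inner_le_norm _ _).trans
          (mul_le_mul (hVb x) (hηg x) (norm_nonneg _) (by positivity))
      have hηm : 0 ≤ (m + 1) * η x ^ m := mul_nonneg (by positivity) (pow_nonneg (hη0 x) m)
      rw [abs_mul (Ψ (u x)), abs_mul (_ * _) (inner ℝ _ _), abs_of_nonneg hηm]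
      calc |Ψ (u x)| * ((m + 1) * η x ^ m * |inner ℝ (V x) (gradient η x)|)
          ≤ 2 * M * ((m + 1) * η x ^ m * (b * ‖g x‖ ^ (p x - 1) * (c / R))) :=
            mul_le_mul (abs_mul_arctan_div_le hM0 _) (mul_le_mul_of_nonneg_left e hηm)
              (mul_nonneg hηm (abs_nonneg _)) (by positivity)
        _ = _ := by rw [htdef]; ring
    have h3 := mul_rpow_sub_one_mul_pow_le (m := m) ht0 (norm_nonneg (g x)) (hη0 x) (hη1 x)
      (hp.one_le x) (by linarith [hp.le_pPlus x]) hδ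
    have h4 : δ * (t / δ) ^ p x ≤ τ := by
      have e : t / δ = t₀ / δ * R ^ (β - 1) := by
        rw [htdef, hM, Real.rpow_sub_one hR0.ne']
        simp only [t₀]
        field_simp
      have hRn : 0 ≤ R ^ (β - 1) := by positivity
      have e2 : (t₀ / δ) ^ p x ≤ max 1 (t₀ / δ) ^ pPlus p :=
        (Real.rpow_le_rpow (by positivity) (le_max_right _ _) (hp.pos x).le).trans
          (Real.rpow_le_rpow_of_exponent_le (le_max_left _ _) (hp.le_pPlus x))
      -- As `β ≤ 1` and `R ≥ 1`, the smallest exponent gives the largest power; this is where `p⁻`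
      -- enters the rate.
      have e3 : (R ^ (β - 1)) ^ p x ≤ R ^ ((β - 1) * pMinus p) := by
        rw [← Real.rpow_mul hR0.le]
        exact Real.rpow_le_rpow_of_exponent_le hR
          (mul_le_mul_of_nonpos_left (hp.pMinus_le x) (by linarith))
      rw [e, Real.mul_rpow (by positivity) hRn, hτ, hT₁, mul_assoc]
      gcongr
    have h5 := neg_le_of_abs_le h2
    have h6 : δ * (‖g x‖ ^ p x * η x ^ (m + 1)) ≤ a / 2 * (θ * η x ^ (m + 1) * ‖g x‖ ^ p x) := by
      have : 0 ≤ a / 2 * (η x ^ (m + 1) * ‖g x‖ ^ p x) * (θ - 1 / 2) := by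
        have : 0 ≤ θ - 1 / 2 := by linarith
        positivity
      rw [hδdef]
      linarith
    rw [hGx, hJx]
    linarith
  have hlocal : ∀ᵐ x, (Metric.closedBall (0 : E n) r).indicator
      (fun x => ‖g x‖ ^ p x / (1 + u x ^ 2)) x ≤ 2 / a * (G x + J x) := by
    filter_upwards [hkey, hu0] with x hx hux
    have hgx : 0 ≤ ‖g x‖ ^ p x := by positivity
    have hζx : 0 ≤ η x ^ (m + 1) := pow_nonneg (hη0 x) _
    have h1 : 1 / (1 + (u x / M) ^ 2) * η x ^ (m + 1) * ‖g x‖ ^ p x ≤ 2 / a * (G x + J x) := by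
      refine le_of_eq_of_le ?_ (mul_le_mul_of_nonneg_left hx (by positivity : 0 ≤ 2 / a))
      field_simp
    refine le_trans ?_ h1
    by_cases hxr : x ∈ Metric.closedBall (0 : E n) r
    · rw [indicator_of_mem hxr, hηR x ((mem_closedBall_zero_iff.1 hxr).trans hr), one_pow, mul_one,
        one_div_mul_eq_div]
      gcongr
      -- `M ≥ 1` replaces the weight by `1 / (1 + u ^ 2)`, which is independent of `R`, so that `R →
      -- ∞` is possible with `r` fixed.
      exact div_le_self hux hM1
    · rw [indicator_of_notMem hxr]
      positivity
  rw [← integral_indicator Metric.isClosed_closedBall.measurableSet]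
  have hRHS : ∫ x, 2 / a * (G x + J x) ≤ 2 / a * (τ * ((2 * R) ^ n * v)) := by
    rw [integral_const_mul, integral_add hGi hJi]
    have hJint : ∫ x, J x = τ * ((2 * R) ^ n * v) := by
      rw [hJ, integral_indicator_const _ Metric.isClosed_closedBall.measurableSet,
        Measure.addHaar_real_closedBall _ _ (by positivity), finrank_euclideanSpace_fin, smul_eq_mul,
        mul_comm]
    rw [hJint]
    gcongr
    linarith
  refine (integral_mono_of_nonneg (Eventually.of_forall fun x =>
    indicator_nonneg (fun y _ => by positivity) x) ((hGi.add hJi).const_mul _) hlocal).trans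
      (hRHS.trans (le_of_eq ?_))
  rw [hτ, Real.rpow_add hR0, Real.rpow_natCast, mul_pow]
  ring

/-! ### Vanishing of the gradient and the Liouville theorem -/

theorem ae_eq_zero_of_energy_bound (hp : IsExponent p) {u : E n → ℝ} {g : E n → E n}
    (hu : AEStronglyMeasurable u) (hgp : LocallyIntegrable fun x => ‖g x‖ ^ p x) {T γ : ℝ}
    (hγ : γ < 0)
    (h : ∀ R : ℝ, 1 ≤ R → ∀ r : ℝ, r ≤ R →
      ∫ x in Metric.closedBall (0 : E n) r, ‖g x‖ ^ p x / (1 + u x ^ 2) ≤ T * R ^ γ) :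
    ∀ᵐ x, g x = 0 := by
  have hr : ∀ r : ℕ, ∀ᵐ x, x ∈ Metric.closedBall (0 : E n) r → g x = 0 := fun r => by
    -- With `r` fixed, `R → ∞` kills the weighted energy on the ball; the weight is positive, so `g`
    -- vanishes there.
    have hlim : Tendsto (fun R : ℝ => T * R ^ γ) atTop (𝓝 (T * 0)) := by
      have := tendsto_rpow_neg_atTop (y := -γ) (by linarith)
      simp only [neg_neg] at this
      exact this.const_mul T
    rw [mul_zero] at hlim
    have hle : ∫ x in Metric.closedBall (0 : E n) r, ‖g x‖ ^ p x / (1 + u x ^ 2) ≤ 0 :=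
      ge_of_tendsto hlim (by
        filter_upwards [eventually_ge_atTop (1 : ℝ), eventually_ge_atTop (r : ℝ)] with R h1 h2
        exact h R h1 r h2)
    have hnn : ∀ x, 0 ≤ ‖g x‖ ^ p x / (1 + u x ^ 2) := fun x => by positivity
    have hgi := hgp.integrableOn_isCompact (isCompact_closedBall (0 : E n) r)
    have hint : IntegrableOn (fun x => ‖g x‖ ^ p x / (1 + u x ^ 2)) (Metric.closedBall 0 r) := by
      refine hgi.mono' ?_ (Eventually.of_forall fun x => ?_)
      · exact (hgi.aestronglyMeasurable.aemeasurable.div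
          ((hu.restrict.aemeasurable.pow_const 2).const_add 1)).aestronglyMeasurable
      · rw [Real.norm_of_nonneg (hnn x)]
        exact div_le_self (by positivity) (by nlinarith [sq_nonneg (u x)])
    have h0 := (integral_eq_zero_iff_of_nonneg (fun x => hnn x) hint).1
      (le_antisymm hle (integral_nonneg hnn))
    filter_upwards [(ae_restrict_iff' Metric.isClosed_closedBall.measurableSet).1 h0] with x hx hxr
    have h1 := hx hxr
    simp only [Pi.zero_apply] at h1
    rw [div_eq_zero_iff] at h1
    rcases h1 with h1 | h1
    · exact norm_eq_zero.1 ((Real.rpow_eq_zero (norm_nonneg _) (hp.pos x).ne').1 h1)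
    · nlinarith [sq_nonneg (u x)]
  filter_upwards [ae_all_iff.2 hr] with x hx
  obtain ⟨r, hxr⟩ := exists_nat_ge ‖x‖
  exact hx r (mem_closedBall_zero_iff.2 hxr)

end VarExp

theorem corollary4p7 (n : ℕ) (p : VarExp.E n → ℝ) (hp : VarExp.IsExponent p)
    (hpn : (n : ℝ) < VarExp.pMinus p)
    (A : VarExp.E n → ℝ → VarExp.E n → VarExp.E n) (hA : VarExp.HasGrowth p A)
    (f : ℝ → ℝ) (hf_nonneg : ∀ t : ℝ, 0 ≤ t → 0 ≤ f t)
    (hf_cont : ContinuousOn f (Set.Ici 0)) (hf_conv : StrictConvexOn ℝ (Set.Ici 0) f)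
    (u : VarExp.E n → ℝ) (hu_nonneg : ∀ᵐ x ∂(MeasureTheory.volume), 0 ≤ u x)
    (hu : VarExp.IsSupersolution p A f u)
    (C α : ℝ) (hα : α < VarExp.pMinus p / VarExp.pPlus p - (n : ℝ) / VarExp.pPlus p)
    (hgrowth : ∀ᵐ x ∂(MeasureTheory.volume), |u x| ≤ C * ‖x‖ ^ α) :
    ∃ c : ℝ, ∀ᵐ x ∂(MeasureTheory.volume), u x = c := by
  obtain ⟨g, ⟨hug, -, hgLp⟩, hsub⟩ := hu
  obtain ⟨hAc, a, b, aMinus, bPlus, -, -, ha0, haa, hab, hbb, hAa, hAb⟩ := hA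
  have hgp := hgLp.locallyIntegrable_rpow hp
  have hV : AEStronglyMeasurable fun x => A x (u x) (g x) :=
    (hAc.aemeasurable_comp hug.1.aestronglyMeasurable.aemeasurable
      hug.2.1.aestronglyMeasurable.aemeasurable).aestronglyMeasurable
  have hb0 : 0 ≤ bPlus := by linarith [haa 0, hab 0, hbb 0]
  have hP := hp.pPlus_pos
  have hmP : VarExp.pMinus p ≤ VarExp.pPlus p := (hp.pMinus_le 0).trans (hp.le_pPlus 0)
  have hm1 := hp.one_lt
  have hαP : α * VarExp.pPlus p < VarExp.pMinus p - n := by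
    rwa [← sub_div, lt_div_iff₀ hP] at hα
  -- Raising a negative `α` to `0` keeps the growth bound for `|x| ≥ 1` and makes `|x| ^ β`
  -- nondecreasing.
  set β := max α 0 with hβ
  have hβ0 : 0 ≤ β := le_max_right _ _
  -- For `α ≤ 0` this is `p⁻ > n`; for `α ≥ 0` it follows from `α p⁻ ≤ α p⁺ < p⁻ - n`. It says that
  -- the exponent `n + (β - 1) p⁻` is negative.
  have hβm : β * VarExp.pMinus p < VarExp.pMinus p - n := by
    rcases le_total α 0 with h | h
    · rw [hβ, max_eq_right h]; linarith
    · rw [hβ, max_eq_left h]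
      nlinarith
  have hβ1 : β ≤ 1 := by
    by_contra! h
    have hn : (0 : ℝ) ≤ n := Nat.cast_nonneg n
    nlinarith
  have hgr : ∀ R : ℝ, 1 ≤ R → ∀ᵐ x : VarExp.E n, R ≤ ‖x‖ → ‖x‖ ≤ 2 * R →
      u x ≤ max 1 (|C| * 2 ^ β) * R ^ β := fun R hR => by
    filter_upwards [hgrowth] with x hx h1 h2
    have hR0 : 0 ≤ R := by linarith
    calc u x ≤ |u x| := le_abs_self _
      _ ≤ C * ‖x‖ ^ α := hx
      _ ≤ |C| * ‖x‖ ^ α := by gcongr; exact le_abs_self C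
      _ ≤ |C| * ‖x‖ ^ β := by
        gcongr
        · exact hR.trans h1
        · exact le_max_left _ _
      _ ≤ |C| * (2 * R) ^ β := by gcongr
      _ = |C| * 2 ^ β * R ^ β := by rw [Real.mul_rpow zero_le_two hR0, mul_assoc]
      _ ≤ _ := by gcongr; exact le_max_right _ _
  obtain ⟨T, -, hT⟩ := VarExp.exists_energy_bound hp hug hu_nonneg hgp hV ha0 hb0
    (fun x => (mul_le_mul_of_nonneg_right (haa x) (by positivity)).trans (hAa x _ _))
    (fun x => (hAb x _ _).trans (mul_le_mul_of_nonneg_right (hbb x) (by positivity)))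
    (fun φ hφ hφ0 => by
      have h1 := (EReal.coe_ennreal_nonneg _).trans (hsub φ hφ hφ0)
      rw [EReal.coe_nonneg] at h1
      linarith)
    (le_max_left _ _) hβ0 hβ1 hgr
  exact hug.exists_ae_eq_const (VarExp.ae_eq_zero_of_energy_bound hp
    hug.1.aestronglyMeasurable hgp (by linarith) hT)
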